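/- Consider $Q\ge1$ transmitter–receiver links and $K\ge1$ eavesdroppers, with arbitrary numbers of antennas. Let $H_{rq}\in\mathbb C^{N_{R_q}\times N_{T_r}}$ be the channel matrix from transmitter $r$ to receiver $q$, $G_{qk}\in\mathbb C^{N_{e,k}\times N_{T_q}}$ the channel matrix from transmitter $q$ to eavesdropper $k$, $P_q>0$ the power budget of transmitter $q$, and $\beta>0$. For each $q$ let $$\mathcal F_q=\{(\Sigma_q,W_q)\in(\mathbb C^{N_{T_q}\times N_{T_q}})^2:\ \Sigma_q\succeq0,\ W_q\succeq0,\ \operatorname{tr}(\Sigma_q+W_q)\le P_q\}$$ (Hermitian positive semidefinite matrices), and for $(\Sigma,W)=(\Sigma_q,W_q)_{q=1}^Q$ put $$M_q=I+H_{qq}W_qH_{qq}^H+\sum_{r\ne q}H_{rq}(\Sigma_r+W_r)H_{rq}^H,\qquad M_{e,q,k}=I+G_{qk}W_qG_{qk}^H+\sum_{r\neq q}G_{rk}(\Sigma_r+W_r)G_{rk}^H.$$ For positive definite Hermitian matrices $S_{q,0}\in\mathbb C^{N_{R_q}\times N_{R_q}}$ and $S_{q,k}\in\mathbb C^{N_{e,k}\times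 N_{e,k}}$ ($1\le k\le K$) let $$\varphi_q=-\operatorname{tr}(S_{q,0}M_q)+\ln|S_{q,0}|+N_{R_q}+\ln|M_q+H_{qq}\Sigma_qH_{qq}^H|,$$ $$\varphi_{e,q,k}=\operatorname{tr}\big(S_{q,k}(M_{e,q,k}+G_{qk}\Sigma_qG_{qk}^H)\big)-\ln|S_{q,k}|-N_{e,k}-\ln|M_{e,q,k}|,$$ $$\bar f_q=\varphi_q-\frac1\beta\ln\Big(\sum_{k=1}^Ke^{\beta\varphi_{e,q,k}}\Big).$$ In the smooth secrecy-rate game, player $q$ maximizes $\bar f_q$ over $(\Sigma_q,W_q)\in\mathcal F_q$ and $S_q=(S_{q,k})_{k=0}^K$. With $\langle A,B\rangle=\operatorname{Re}\operatorname{tr}(A^HB)$, a quasi-Nash equilibrium (QNE) is a point $(\Sigma_q,W_q)_q\in\prod_q\mathcal F_q$ together with positive definite $(S_{q,k})_{q,k}$ such that, for every $q$, $S_q$ maximizes $\bar f_q$ over all tuples of positive definite matrices with $(\Sigma,W)$ fixed, and such that $$\sum_{q=1}^Q\Big(\langle\Sigma_q'-\Sigma_q,\,-\nabla_{\Sigma_q}\bar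 f_q\rangle+\langle W_q'-W_q,\,-\nabla_{W_q}\bar f_q\rangle\Big)\ \ge\ 0\qquad\text{for all }(\Sigma_q',W_q')_{q}\in\prod_{q=1}^Q\mathcal F_q,$$ where the gradients (with respect to $\langle\cdot,\cdot\rangle$ on Hermitian matrices, and in the player's own $(\Sigma_q,W_q)$, all other matrices being fixed) exist and are taken at the given point. Theorem. For all such data, the smooth secrecy-rate game has at least one quasi-Nash equilibrium. -/

import Mathlib

open scoped Matrix ComplexOrder

noncomputable section

namespace SecrecyGame

/-- Complex square matrices of size `n`. -/
abbrev CMat (n : ℕ) : Type := Matrix (Fin n) (Fin n) ℂ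

/-- The data of a MIMO wiretap interference network with `Q` links and `K` eavesdroppers.
`H r q` is the channel from transmitter `r` to receiver `q`, and `G q k` the channel from
transmitter `q` to eavesdropper `k`; `P q` is the power budget of transmitter `q`. -/
structure Network (Q K : ℕ) where
  /-- numbers of transmit antennas -/
  NT : Fin Q → ℕ
  /-- numbers of receive antennas -/
  NR : Fin Q → ℕ
  /-- numbers of antennas of the eavesdroppers -/
  Ne : Fin K → ℕ
  /-- channels between transmitters (first index) and receivers (second index) -/
  H : ∀ r q : Fin Q, Matrix (Fin (NR q)) (Fin (NT r)) ℂ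
  /-- channels between transmitters and eavesdroppers -/
  G : ∀ (q : Fin Q) (k : Fin K), Matrix (Fin (Ne k)) (Fin (NT q)) ℂ
  /-- power budgets -/
  P : Fin Q → ℝ

/-- The real inner product `Re Tr (Aᴴ B)` of complex matrices. -/
def rinner {n : ℕ} (A B : CMat n) : ℝ := (Aᴴ * B).trace.re

/-- `ln |A|`, used for Hermitian positive definite `A` (whose determinant is real positive). -/
def lnDet {n : ℕ} (A : CMat n) : ℝ := Real.log A.det.re

/-- The real linear functional `D ↦ Re Tr (G₁ᴴ D₁) + Re Tr (G₂ᴴ D₂)` on pairs of matrices. -/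
def pairing {n : ℕ} (g : CMat n × CMat n) : (CMat n × CMat n) →L[ℝ] ℝ :=
  LinearMap.toContinuousLinearMap
    { toFun := fun d => rinner g.1 d.1 + rinner g.2 d.2
      map_add' := by
        intro x y
        simp only [rinner, Prod.fst_add, Prod.snd_add, Matrix.mul_add, Matrix.trace_add,
          Complex.add_re]
        ring
      map_smul' := by
        intro c x
        simp only [rinner, Prod.smul_fst, Prod.smul_snd, Matrix.mul_smul, Matrix.trace_smul,
          Complex.smul_re, smul_eq_mul, RingHom.id_apply]
        ring }

/-- Pairs of Hermitian matrices. -/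
def hermitianPairs (n : ℕ) : Set (CMat n × CMat n) :=
  {p | p.1.IsHermitian ∧ p.2.IsHermitian}

/-- `g = (g₁, g₂)` is the gradient at `p` of the real function `f` of a pair of Hermitian
matrices, with respect to the inner product `Re Tr (Aᴴ B)`: a pair of Hermitian matrices that
represents the Fréchet derivative of `f` on the real vector space of Hermitian pairs. -/
def HasMatrixGradientAt {n : ℕ} (f : CMat n × CMat n → ℝ) (g p : CMat n × CMat n) : Prop :=
  g ∈ hermitianPairs n ∧ HasFDerivWithinAt f (pairing g) (hermitianPairs n) p

namespace Network

variable {Q K : ℕ} (N : Network Q K)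

/-- What player `q` transmits: the pair `(Σ_q, W_q)` of covariance matrices of its information
signal and of its artificial noise. -/
abbrev Strategy (q : Fin Q) : Type := CMat (N.NT q) × CMat (N.NT q)

/-- The pairs `(Σ_q, W_q)` of all players. -/
abbrev Profile : Type := ∀ q : Fin Q, N.Strategy q

/-- The auxiliary matrices `(S_{q,0}, (S_{q,k})_k)` of player `q`. -/
abbrev Aux (q : Fin Q) : Type := CMat (N.NR q) × (∀ k : Fin K, CMat (N.Ne k))

/-- The strategy set `{(Σ, W) | Σ ⪰ 0, W ⪰ 0, tr (Σ + W) ≤ P_q}` of player `q`. -/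
def strategySet (q : Fin Q) : Set (N.Strategy q) :=
  {p | p.1.PosSemidef ∧ p.2.PosSemidef ∧ (p.1 + p.2).trace.re ≤ N.P q}

/-- The Cartesian product of the strategy sets. -/
def feasible : Set N.Profile := {X | ∀ q, X q ∈ N.strategySet q}

/-- The admissible auxiliary matrices: `S_{q,k} ⪰ 0` with `ln |S_{q,k}|` finite, that is,
positive definite (for singular `S_{q,k}` the objective below is `-∞`). -/
def auxSet (q : Fin Q) : Set (N.Aux q) :=
  {S | S.1.PosDef ∧ ∀ k, (S.2 k).PosDef}

/-- `M_q = I + H_qq W_q H_qqᴴ + ∑_{r ≠ q} H_rq (Σ_r + W_r) H_rqᴴ`. -/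
def rxCov (q : Fin Q) (X : N.Profile) : CMat (N.NR q) :=
  1 + N.H q q * (X q).2 * (N.H q q)ᴴ
    + ∑ r ∈ Finset.univ.erase q, N.H r q * ((X r).1 + (X r).2) * (N.H r q)ᴴ

/-- `M_{e,q,k} = I + G_qk W_q G_qkᴴ + ∑_{r ≠ q} G_rk (Σ_r + W_r) G_rkᴴ`. -/
def eveCov (q : Fin Q) (k : Fin K) (X : N.Profile) : CMat (N.Ne k) :=
  1 + N.G q k * (X q).2 * (N.G q k)ᴴ
    + ∑ r ∈ Finset.univ.erase q, N.G r k * ((X r).1 + (X r).2) * (N.G r k)ᴴ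

/-- `φ_q = -tr (S₀ M_q) + ln |S₀| + N_{R_q} + ln |M_q + H_qq Σ_q H_qqᴴ|`. -/
def phi (q : Fin Q) (X : N.Profile) (S₀ : CMat (N.NR q)) : ℝ :=
  -(S₀ * N.rxCov q X).trace.re + lnDet S₀ + (N.NR q : ℝ)
    + lnDet (N.rxCov q X + N.H q q * (X q).1 * (N.H q q)ᴴ)

/-- `φ_{e,q,k} = tr (S (M_{e,q,k} + G_qk Σ_q G_qkᴴ)) - ln |S| - N_{e,k} - ln |M_{e,q,k}|`. -/
def phiEve (q : Fin Q) (k : Fin K) (X : N.Profile) (S : CMat (N.Ne k)) : ℝ :=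
  (S * (N.eveCov q k X + N.G q k * (X q).1 * (N.G q k)ᴴ)).trace.re
    - lnDet S - (N.Ne k : ℝ) - lnDet (N.eveCov q k X)

/-- The smooth objective of player `q`,
`f̄_q = φ_q - (1/β) ln (∑_k exp (β φ_{e,q,k}))`. -/
def objective (β : ℝ) (q : Fin Q) (X : N.Profile) (S : N.Aux q) : ℝ :=
  N.phi q X S.1 - 1 / β * Real.log (∑ k, Real.exp (β * N.phiEve q k X (S.2 k)))

/-- `X` solves the variational inequality of the map `F` over the set of feasible profiles, for
the inner product `∑_q Re Tr (·ᴴ ·)`; only the value `F X = F` at `X` matters. -/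
def SolvesVI (F X : N.Profile) : Prop :=
  X ∈ N.feasible ∧ ∀ Z ∈ N.feasible,
    0 ≤ ∑ q, (rinner (Z q - X q).1 (F q).1 + rinner (Z q - X q).2 (F q).2)

/-- Quasi-Nash equilibria of the smooth game in which player `q` maximizes
`f̄_q(Σ_q, W_q, S_q)` over `(Σ_q, W_q)` in its strategy set and over `S_q`: the auxiliary matrices
are optimal for the given covariance matrices, and the covariance matrices solve the variational
inequality of `F = (-∇_{Σ_q} f̄_q, -∇_{W_q} f̄_q)_q`, where the gradients are taken in the player's
own covariance matrices, with those of the others and all auxiliary matrices fixed. -/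
def IsQNE (β : ℝ) (X : N.Profile) (S : ∀ q, N.Aux q) : Prop :=
  (∀ q, S q ∈ N.auxSet q ∧ IsMaxOn (N.objective β q X) (N.auxSet q) (S q)) ∧
  ∃ F : N.Profile,
    (∀ q, HasMatrixGradientAt (fun p => N.objective β q (Function.update X q p) (S q))
      (-F q) (X q)) ∧
    N.SolvesVI F X

end Network

end SecrecyGame

end

/-!
For a fixed profile `X` of covariance matrices the best auxiliary matrices are explicit: by
`ln |S| + ln |M| ≤ tr (S M) - n` (`lnDet_add_lnDet_le`) they are the inverses collected in `optAux`.
A quasi-Nash equilibrium is therefore a solution of the variational inequality whose map at `X` is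
minus the gradient of the objectives, taken with the auxiliary matrices frozen at `optAux q X`.
Jacobi's formula gives this gradient in closed form (`grad`, `hasMatrixGradientAt_objective`). All
the matrices inverted in it are at least the identity, so it is continuous on the set of feasible
profiles (`continuousOn_grad_optAux`), which is compact and convex. No convexity or monotonicity of
the objectives is needed: a continuous variational inequality over a compact convex set always has
a solution (`exists_variationalInequality_solution`).

That fact is reduced to Brouwer's fixed point theorem on a simplex, of which a combinatorial proof
is given (`exists_fixedPoint_stdSimplex`). It rests on Scarf's lemma
(`Scarf.exists_dominated_all_colours`), in which the triangulation of Sperner's lemma is replaced by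
the sets dominated for a family of linear orders. These behave like the cells of a triangulation:
a facet lies in exactly two cells, save for one facet on the boundary, and a parity count yields a
cell that carries all colours.
-/

/-! ### Scarf's lemma -/

namespace Scarf

section Dominated

variable {I V : Type*} (r : I → V → ℤ)

/-- A set `R` is dominated for the rankings `r i` if every point `y` is ranked, by some `i`, at
most as high as every element of `R`. -/
def Dominated (R : Finset V) : Prop := ∀ y, ∃ i, ∀ x ∈ R, r i y ≤ r i x

variable {r}

theorem Dominated.mono {R D : Finset V} (h : Dominated r R) (hD : D ⊆ R) : Dominated r D :=
  fun y => (h y).imp fun _ hi x hx => hi x (hD hx)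

variable [Fintype I] [DecidableEq I] [DecidableEq V]

/-- In a set with as many points as colours, in which some colour is missing, the number of points
whose removal leaves all the colours except `i₀` is zero or two. -/
theorem even_card_erase_colours {R : Finset V} (c : V → I) (i₀ : I)
    (hcard : R.card = Fintype.card I) (hR : R.image c ≠ Finset.univ) :
    Even (R.filter fun v => (R.erase v).image c = Finset.univ.erase i₀).card := by
  rcases Finset.eq_empty_or_nonempty
    (R.filter fun v => (R.erase v).image c = Finset.univ.erase i₀) with h | ⟨v, hv⟩
  · simp [h]
  obtain ⟨hvR, hv⟩ := Finset.mem_filter.1 hv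
  have hinj : Set.InjOn c (R.erase v : Finset V) := by
    rw [← Finset.card_image_iff, hv, Finset.card_erase_of_mem (Finset.mem_univ _),
      Finset.card_erase_of_mem hvR, hcard, Finset.card_univ]
  have himg : ∀ u ∈ R, insert (c u) ((R.erase u).image c) = R.image c := by
    intro u hu
    rw [← Finset.image_insert, Finset.insert_erase hu]
  have hcv : c v ≠ i₀ := by
    intro h
    apply hR
    rw [← himg v hvR, hv, h, Finset.insert_erase (Finset.mem_univ _)]
  have hw : c v ∈ (R.erase v).image c := by rw [hv]; simp [hcv]
  obtain ⟨w, hwR, hwv⟩ := Finset.mem_image.1 hw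
  have hwne : w ≠ v := Finset.ne_of_mem_erase hwR
  have hwR' : w ∈ R := Finset.mem_of_mem_erase hwR
  have hset : (R.filter fun v => (R.erase v).image c = Finset.univ.erase i₀) = {v, w} := by
    ext u
    simp only [Finset.mem_filter, Finset.mem_insert, Finset.mem_singleton]
    constructor
    · rintro ⟨huR, hu⟩
      by_contra! hcon
      have huv : u ∈ R.erase v := Finset.mem_erase.2 ⟨hcon.1, huR⟩
      have hcu : c u ∈ (R.erase u).image c := by
        rw [hu, ← hv]; exact Finset.mem_image_of_mem c huv
      obtain ⟨z, hz, hzu⟩ := Finset.mem_image.1 hcu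
      by_cases hzv : z = v
      · exact hcon.2 (hinj huv hwR (by rw [hwv, ← hzu, hzv]))
      · exact Finset.ne_of_mem_erase hz
          (hinj (Finset.mem_erase.2 ⟨hzv, Finset.mem_of_mem_erase hz⟩) huv hzu)
    · rintro (rfl | rfl)
      · exact ⟨hvR, hv⟩
      · refine ⟨hwR', ?_⟩
        rw [← hv]
        ext i
        simp only [Finset.mem_image, Finset.mem_erase]
        constructor
        · rintro ⟨x, ⟨hx, hxR⟩, rfl⟩
          by_cases hxv : x = v
          · exact ⟨u, ⟨hwne, hwR'⟩, by rw [hxv, hwv]⟩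
          · exact ⟨x, ⟨hxv, hxR⟩, rfl⟩
        · rintro ⟨x, ⟨hx, hxR⟩, rfl⟩
          by_cases hxv : x = u
          · exact ⟨v, ⟨hwne.symm, hvR⟩, by rw [hxv, hwv]⟩
          · exact ⟨x, ⟨hxv, hxR⟩, rfl⟩
  rw [hset, Finset.card_pair hwne.symm]
  exact even_two

variable [Fintype V]

open Classical in
/-- A dominated set with one element less than there are rankings extends to exactly two dominated
sets. Indeed exactly two rankings `a`, `b` have the same lowest element on `D`, and for
`c ∈ {a, b}` the extension is by the highest point, in the ranking `c`, among those that all the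
other rankings place above the minimum of `D`. The hypothesis `hU`, that there are such points, holds off the
boundary. -/
theorem card_dominated_insert {D : Finset V} (hr : ∀ i, Function.Injective (r i))
    (hne : D.Nonempty) (hcard : D.card + 1 = Fintype.card I) (hD : Dominated r D)
    (hU : ∀ a, ∃ y, ∀ i, i ≠ a → ∃ x ∈ D, r i x < r i y) :
    (Finset.univ.filter fun v => v ∉ D ∧ Dominated r (insert v D)).card = 2 := by
  have hm : ∀ i, ∃ x ∈ D, ∀ x' ∈ D, r i x ≤ r i x' := fun i =>
    Finset.exists_min_image D (r i) hne
  choose m hmD hmin using hm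
  have hsurj : ∀ x ∈ D, ∃ i, m i = x := by
    intro x hx
    obtain ⟨i, hi⟩ := hD x
    exact ⟨i, hr i (le_antisymm (hmin i x hx) (hi _ (hmD i)))⟩
  -- a ranking whose lowest element is also the lowest element of another ranking may be left out
  have hinj : ∀ c, (∃ c', c' ≠ c ∧ m c' = m c) →
      ∀ i j, i ≠ c → j ≠ c → m i = m j → i = j := by
    rintro c ⟨c', hc', hcc⟩ i j hi hj hij
    have himg : (Finset.univ.erase c).image m = D := by
      ext x
      simp only [Finset.mem_image, Finset.mem_erase, Finset.mem_univ, and_true]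
      constructor
      · rintro ⟨i, -, rfl⟩; exact hmD i
      · intro hx
        obtain ⟨i, rfl⟩ := hsurj x hx
        by_cases h : i = c
        · exact ⟨c', hc', by rw [hcc, h]⟩
        · exact ⟨i, h, rfl⟩
    have hc : ((Finset.univ.erase c).image m).card = (Finset.univ.erase c).card := by
      rw [himg, Finset.card_erase_of_mem (Finset.mem_univ _), Finset.card_univ]; omega
    exact Finset.card_image_iff.1 hc (by simpa using hi) (by simpa using hj) hij
  obtain ⟨a, -, b, -, hab, hmab⟩ := Finset.exists_ne_map_eq_of_card_lt_of_maps_to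
    (s := (Finset.univ : Finset I)) (t := D) (f := m) (by rw [Finset.card_univ]; omega)
    (fun i _ => hmD i)
  have hpair : ∀ i j, i ≠ j → m i = m j → i = a ∨ i = b := by
    intro i j hij h
    by_contra! hcon
    by_cases hja : j = a
    · exact hij (hinj b ⟨a, hab, hmab⟩ i j hcon.2 (by rw [hja]; exact hab) h)
    · exact hij (hinj a ⟨b, hab.symm, hmab.symm⟩ i j hcon.1 hja h)
  -- the point that replaces `m c` as the lowest element in the ranking `c`
  have ht : ∀ c, ∃ y, (∀ i, i ≠ c → r i (m i) < r i y) ∧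
      ∀ z, (∀ i, i ≠ c → r i (m i) < r i z) → r c z ≤ r c y := by
    intro c
    obtain ⟨y, hy⟩ := hU c
    obtain ⟨t, ht, htmax⟩ := Finset.exists_max_image
      (Finset.univ.filter fun y => ∀ i, i ≠ c → r i (m i) < r i y) (r c)
      ⟨y, by
        simp only [Finset.mem_filter, Finset.mem_univ, true_and]
        intro i hi
        obtain ⟨x, hx, hlt⟩ := hy i hi
        exact (hmin i x hx).trans_lt hlt⟩
    exact ⟨t, by simpa using ht, fun z hz => htmax z (by simpa using hz)⟩
  choose t htU htmax using ht
  have hlow : ∀ c, r c (t c) ≤ r c (m c) := by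
    intro c
    obtain ⟨i, hi⟩ := hD (t c)
    by_cases h : i = c
    · subst h; exact hi _ (hmD i)
    · exact absurd (hi _ (hmD i)) (not_le.2 (htU c i h))
  have htab : t a ≠ t b := by
    intro h
    have h1 := htU a b hab.symm
    rw [h] at h1
    exact absurd (hlow b) (not_le.2 h1)
  have hgood : ∀ c c', c' ≠ c → m c' = m c → t c ∉ D ∧ Dominated r (insert (t c) D) := by
    intro c c' hc hcc
    refine ⟨fun hmem => ?_, fun y => ?_⟩
    · obtain ⟨i, hi⟩ := hsurj _ hmem
      by_cases h : i = c
      · have := htU c c' hc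
        rw [← hi, h, hcc] at this
        exact lt_irrefl _ this
      · have := htU c i h
        rw [← hi] at this
        exact lt_irrefl _ this
    · by_cases hy : ∀ i, i ≠ c → r i (m i) < r i y
      · refine ⟨c, fun x hx => ?_⟩
        rcases Finset.mem_insert.1 hx with rfl | hx
        · exact htmax c y hy
        · exact (htmax c y hy).trans ((hlow c).trans (hmin c x hx))
      · push Not at hy
        obtain ⟨i, hic, hi⟩ := hy
        refine ⟨i, fun x hx => ?_⟩
        rcases Finset.mem_insert.1 hx with rfl | hx
        · exact hi.trans (htU c i hic).le
        · exact hi.trans (hmin i x hx)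
  have hset : (Finset.univ.filter fun v => v ∉ D ∧ Dominated r (insert v D)) = {t a, t b} := by
    ext v
    simp only [Finset.mem_filter, Finset.mem_univ, true_and, Finset.mem_insert,
      Finset.mem_singleton]
    constructor
    · rintro ⟨hv, hdom⟩
      obtain ⟨c, hc⟩ := hdom v
      have hcm : r c v < r c (m c) := lt_of_le_of_ne (hc _ (Finset.mem_insert_of_mem (hmD c)))
        fun h => hv (by rw [hr c h]; exact hmD c)
      have hrep : ∀ x ∈ D, ∃ i, i ≠ c ∧ m i = x ∧ r i (m i) < r i v := by
        intro x hx
        obtain ⟨i, hi⟩ := hdom x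
        have hmi : m i = x := hr i (le_antisymm (hmin i x hx)
          (hi _ (Finset.mem_insert_of_mem (hmD i))))
        have hle : r i (m i) ≤ r i v := by
          rw [hmi]; exact hi _ (Finset.mem_insert_self _ _)
        refine ⟨i, ?_, hmi, lt_of_le_of_ne hle fun h => hv (by rw [← hr i h]; exact hmD i)⟩
        rintro rfl
        exact absurd hle (not_le.2 hcm)
      obtain ⟨c', hc', hcc, -⟩ := hrep _ (hmD c)
      have hvU : ∀ i, i ≠ c → r i (m i) < r i v := by
        intro i hi
        obtain ⟨j, hj, hji, hlt⟩ := hrep _ (hmD i)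
        rwa [hinj c ⟨c', hc', hcc⟩ j i hj hi hji] at hlt
      have hvt : v = t c := by
        obtain ⟨i, hi⟩ := hdom (t c)
        have hic : i = c := by
          by_contra h
          exact absurd (hi _ (Finset.mem_insert_of_mem (hmD i))) (not_le.2 (htU c i h))
        subst hic
        exact hr i (le_antisymm (htmax i v hvU) (hi _ (Finset.mem_insert_self _ _)))
      rcases hpair c c' hc'.symm hcc.symm with rfl | rfl
      · exact Or.inl hvt
      · exact Or.inr hvt
    · rintro (rfl | rfl)
      · exact hgood a b hab.symm hmab.symm
      · exact hgood b a hab hmab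
  rw [hset, Finset.card_pair htab]

open Classical in
/-- The set of all slack points but one extends to exactly one dominated set: by the highest
ordinary point in the ranking of the missing slack point. -/
theorem card_dominated_insert_slack (hr : ∀ i, Function.Injective (r i)) (s : I → V)
    (hs₁ : ∀ i y, y ≠ s i → r i (s i) < r i y)
    (hs₂ : ∀ i j y, j ≠ i → (∀ k, y ≠ s k) → r i y < r i (s j))
    (hs : Function.Injective s) (i₀ : I) :
    (Finset.univ.filter fun v => v ∉ (Finset.univ.erase i₀).image s ∧
      Dominated r (insert v ((Finset.univ.erase i₀).image s))).card = 1 := by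
  have hmem : ∀ y, y ∉ (Finset.univ.erase i₀).image s ↔ ∀ j, j ≠ i₀ → s j ≠ y := by
    intro y; simp
  obtain ⟨t, ht, htmax⟩ := Finset.exists_max_image
    (Finset.univ.filter fun y => y ∉ (Finset.univ.erase i₀).image s) (r i₀)
    ⟨s i₀, by
      rw [Finset.mem_filter, hmem]
      exact ⟨Finset.mem_univ _, fun j hj h => hj (hs h)⟩⟩
  simp only [Finset.mem_filter, Finset.mem_univ, true_and] at ht htmax
  rw [Finset.card_eq_one]
  refine ⟨t, ?_⟩
  ext v
  simp only [Finset.mem_filter, Finset.mem_univ, true_and, Finset.mem_singleton]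
  constructor
  · rintro ⟨hv, hdom⟩
    obtain ⟨i, hi⟩ := hdom t
    have hi0 : i = i₀ := by
      by_contra h
      have h1 := hi (s i) (Finset.mem_insert_of_mem
        (Finset.mem_image_of_mem s (Finset.mem_erase.2 ⟨h, Finset.mem_univ _⟩)))
      exact absurd (hs₁ i t ((hmem t).1 ht i h).symm) (not_lt.2 h1)
    subst hi0
    exact hr i (le_antisymm (htmax v hv) (hi v (Finset.mem_insert_self _ _)))
  · rintro rfl
    refine ⟨ht, fun y => ?_⟩
    by_cases hy : ∀ j, j ≠ i₀ → s j ≠ y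
    · refine ⟨i₀, fun x hx => ?_⟩
      rcases Finset.mem_insert.1 hx with rfl | hx
      · exact htmax y ((hmem y).2 hy)
      · obtain ⟨j, hj, rfl⟩ := Finset.mem_image.1 hx
        have hj0 := Finset.ne_of_mem_erase hj
        by_cases hys : y = s i₀
        · rw [hys]
          exact (hs₁ i₀ _ fun h => hj0 (hs h)).le
        · refine (hs₂ i₀ j y hj0 fun k hk => ?_).le
          by_cases hk0 : k = i₀
          · exact hys (by rw [hk, hk0])
          · exact hy k hk0 hk.symm
    · push Not at hy
      obtain ⟨j, -, rfl⟩ := hy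
      refine ⟨j, fun x _ => ?_⟩
      by_cases h : x = s j
      · rw [h]
      · exact (hs₁ j x h).le

/-- **Scarf's lemma**. Suppose that the ranking `i` has the slack point `s i` at its bottom and the
other slack points at its top. If the points are coloured and `s i` has colour `i`, some dominated
set contains each colour exactly once. -/
theorem exists_dominated_all_colours [Nonempty I] (hr : ∀ i, Function.Injective (r i)) (s : I → V)
    (hs₁ : ∀ i y, y ≠ s i → r i (s i) < r i y)
    (hs₂ : ∀ i j y, j ≠ i → (∀ k, y ≠ s k) → r i y < r i (s j))
    (c : V → I) (hc : ∀ i, c (s i) = i) :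
    ∃ R : Finset V, Dominated r R ∧ R.card = Fintype.card I ∧ R.image c = Finset.univ := by
  classical
  by_contra! hcon
  obtain ⟨i₀⟩ := ‹Nonempty I›
  have hs : Function.Injective s := fun i j h => by rw [← hc i, h, hc]
  let rooms : Finset (Finset V) :=
    Finset.univ.filter fun R => Dominated r R ∧ R.card = Fintype.card I
  let doors : Finset (Finset V) := Finset.univ.filter fun D =>
    D.card + 1 = Fintype.card I ∧ D.image c = Finset.univ.erase i₀
  -- count in two ways the pairs of a room `R` and a door `R \ {v}` of it
  have hcount : ∑ R ∈ rooms, (R.filter fun v => (R.erase v).image c = Finset.univ.erase i₀).card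
      = ∑ D ∈ doors, (Finset.univ.filter fun v => v ∉ D ∧ Dominated r (insert v D)).card := by
    rw [← Finset.card_sigma, ← Finset.card_sigma]
    refine Finset.card_nbij' (fun p => ⟨p.1.erase p.2, p.2⟩) (fun p => ⟨insert p.2 p.1, p.2⟩)
      ?_ ?_ ?_ ?_
    · rintro ⟨R, v⟩ h
      simp only [rooms, doors, Finset.coe_sigma, Set.mem_sigma_iff, Finset.mem_coe,
        Finset.mem_filter, Finset.mem_univ, true_and] at h ⊢
      obtain ⟨⟨h1, h2⟩, h3, h4⟩ := h
      refine ⟨⟨?_, h4⟩, Finset.notMem_erase _ _, by rwa [Finset.insert_erase h3]⟩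
      rw [Finset.card_erase_add_one h3, h2]
    · rintro ⟨D, v⟩ h
      simp only [rooms, doors, Finset.coe_sigma, Set.mem_sigma_iff, Finset.mem_coe,
        Finset.mem_filter, Finset.mem_univ, true_and] at h ⊢
      obtain ⟨⟨h1, h2⟩, h3, h4⟩ := h
      refine ⟨⟨h4, by rw [Finset.card_insert_of_notMem h3, h1]⟩, Finset.mem_insert_self _ _, ?_⟩
      rw [Finset.erase_insert h3, h2]
    · rintro ⟨R, v⟩ h
      simp only [Finset.coe_sigma, Set.mem_sigma_iff, Finset.mem_coe, Finset.mem_filter] at h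
      simp [Finset.insert_erase h.2.1]
    · rintro ⟨D, v⟩ h
      simp only [Finset.coe_sigma, Set.mem_sigma_iff, Finset.mem_coe, Finset.mem_filter] at h
      simp [Finset.erase_insert h.2.2.1]
  have heven : Even (∑ R ∈ rooms,
      (R.filter fun v => (R.erase v).image c = Finset.univ.erase i₀).card) := by
    refine Finset.even_sum _ fun R hR => ?_
    simp only [rooms, Finset.mem_filter, Finset.mem_univ, true_and] at hR
    exact even_card_erase_colours c i₀ hR.2 (hcon R hR.1 hR.2)
  have hD₀card : ((Finset.univ.erase i₀).image s).card + 1 = Fintype.card I := by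
    rw [Finset.card_image_of_injective _ hs, Finset.card_erase_add_one (Finset.mem_univ _),
      Finset.card_univ]
  have hD₀ : (Finset.univ.erase i₀).image s ∈ doors := by
    simp only [doors, Finset.mem_filter, Finset.mem_univ, true_and]
    refine ⟨hD₀card, ?_⟩
    rw [Finset.image_image]
    have : c ∘ s = id := funext hc
    rw [this, Finset.image_id]
  rw [hcount, ← Finset.add_sum_erase _ _ hD₀,
    card_dominated_insert_slack hr s hs₁ hs₂ hs i₀, add_comm] at heven
  refine Nat.not_even_iff_odd.2 (Even.add_one ?_) heven
  refine Finset.even_sum _ fun D hD => ?_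
  rw [Finset.mem_erase] at hD
  obtain ⟨hne, hD⟩ := hD
  simp only [doors, Finset.mem_filter, Finset.mem_univ, true_and] at hD
  by_cases hdom : Dominated r D
  · obtain ⟨x, hxD, hx⟩ : ∃ x ∈ D, ∀ k, x ≠ s k := by
      by_contra! hall
      refine hne (Finset.eq_of_subset_of_card_le (fun x hx => ?_) (by omega))
      obtain ⟨k, rfl⟩ := hall x hx
      refine Finset.mem_image_of_mem s ?_
      rw [← hD.2, ← hc k]
      simpa [hc] using Finset.mem_image_of_mem c hx
    rw [card_dominated_insert hr ⟨x, hxD⟩ hD.1 hdom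
      fun a => ⟨s a, fun i hi => ⟨x, hxD, hs₂ i a x hi.symm hx⟩⟩]
    exact even_two
  · rw [Finset.filter_false_of_mem]
    · simp
    · rintro v - ⟨-, h⟩
      exact hdom (h.mono (Finset.subset_insert _ _))

end Dominated

end Scarf

/-! ### Lattice points of the simplex -/

namespace Scarf

variable {I : Type*} [Fintype I] [DecidableEq I] [Nonempty I]

/-- Colour the lattice points of the simplex `∑ i, x i = N`. Some nonempty set of lattice points,
of diameter at most the number of coordinates, meets every colour `i` for which the coordinate
`i` is not close to zero. No boundary condition on the colouring is needed. -/
theorem exists_close_lattice_points (N : ℕ) (c : (I → ℕ) → I) :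
    ∃ R : Finset (I → ℕ), R.Nonempty ∧ (∀ x ∈ R, ∑ i, x i = N) ∧
      (∀ x ∈ R, ∀ y ∈ R, ∀ i, x i ≤ y i + Fintype.card I) ∧
      ∀ i, (∃ z ∈ R, c z = i) ∨ ∀ x ∈ R, x i ≤ Fintype.card I := by
  classical
  let T := {x : I → Fin (N + 1) // ∑ i, (x i : ℕ) = N}
  have mkT : ∀ y : I → ℕ, ∑ i, y i = N → ∃ t : T, ∀ i, (t.1 i : ℕ) = y i := by
    intro y hy
    have hle : ∀ i, y i < N + 1 := fun i => by
      have := Finset.single_le_sum (f := y) (fun j _ => Nat.zero_le _) (Finset.mem_univ i)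
      omega
    exact ⟨⟨fun i => ⟨y i, hle i⟩, hy⟩, fun i => rfl⟩
  let M : ℤ := Fintype.card T
  let e : T → ℤ := fun t => (Fintype.equivFin T t : ℕ)
  let e' : I → ℤ := fun i => (Fintype.equivFin I i : ℕ)
  have he : ∀ t, 0 ≤ e t ∧ e t < M := fun t => by
    have := (Fintype.equivFin T t).2
    simp only [e, M]; omega
  have he' : ∀ i, 0 ≤ e' i := fun i => by simp only [e']; omega
  have hei : Function.Injective e := fun s t h => by
    apply (Fintype.equivFin T).injective
    apply Fin.ext
    simp only [e] at h; omega
  have hei' : Function.Injective e' := fun s t h => by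
    apply (Fintype.equivFin I).injective
    apply Fin.ext
    simp only [e'] at h; omega
  -- compare lattice points by the coordinate `i`, and break ties by the enumeration `e`
  let r : I → T ⊕ I → ℤ := fun i v => match v with
    | Sum.inl t => ((t.1 i : ℕ) : ℤ) * M + e t
    | Sum.inr j => if j = i then -1 else (N + 1) * M + e' j
  have hrl : ∀ i t, r i (Sum.inl t) = ((t.1 i : ℕ) : ℤ) * M + e t := fun i t => rfl
  have hrr : ∀ i j, r i (Sum.inr j) = if j = i then -1 else (N + 1) * M + e' j := fun i j => rfl
  have hM : 0 ≤ M := by simp only [M]; omega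
  have hl0 : ∀ i t, 0 ≤ r i (Sum.inl t) := fun i t => by
    rw [hrl]; have := (he t).1; positivity
  have hl1 : ∀ i t, r i (Sum.inl t) < (N + 1) * M := fun i t => by
    rw [hrl]
    have h1 : (((t.1 i : ℕ) : ℤ)) ≤ N := by have := (t.1 i).2; omega
    nlinarith [(he t).2]
  have hr0 : ∀ i j, j ≠ i → (N + 1) * M ≤ r i (Sum.inr j) := fun i j h => by
    rw [hrr, if_neg h]; linarith [he' j]
  have hrs : ∀ i, r i (Sum.inr i) = -1 := fun i => by rw [hrr, if_pos rfl]
  have hNM : 0 ≤ (N + 1) * M := by positivity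
  have hlt : ∀ i s t, r i (Sum.inl s) ≤ r i (Sum.inl t) → (s.1 i : ℕ) ≤ t.1 i := by
    intro i s t h
    rw [hrl, hrl] at h
    by_contra! hcon
    have h1 : ((t.1 i : ℕ) : ℤ) + 1 ≤ ((s.1 i : ℕ) : ℤ) := by exact_mod_cast hcon
    nlinarith [he s, he t]
  have hinj : ∀ i, Function.Injective (r i) := by
    rintro i (s | j) (t | k) h
    · have h1 : (s.1 i : ℕ) = t.1 i := le_antisymm (hlt i s t h.le) (hlt i t s h.ge)
      rw [hrl, hrl, h1] at h
      have h2 : s = t := hei (by linarith)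
      rw [h2]
    · exfalso
      by_cases hk : k = i
      · subst hk; linarith [hrs k, hl0 k s]
      · linarith [hr0 i k hk, hl1 i s]
    · exfalso
      by_cases hk : j = i
      · subst hk; linarith [hrs j, hl0 j t]
      · linarith [hr0 i j hk, hl1 i t]
    · by_cases hj : j = i <;> by_cases hk : k = i
      · rw [hj, hk]
      · subst hj; linarith [hrs j, hr0 j k hk]
      · subst hk; linarith [hrs k, hr0 k j hj]
      · rw [hrr, hrr, if_neg hj, if_neg hk] at h
        have h2 : j = k := hei' (by linarith)
        rw [h2]
  obtain ⟨R, hdom, hRcard, hRcol⟩ := exists_dominated_all_colours (r := r) hinj Sum.inr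
    (by
      rintro i (t | k) h
      · linarith [hrs i, hl0 i t]
      · have hk : k ≠ i := fun hk => h (by rw [hk])
        linarith [hrs i, hr0 i k hk])
    (by
      rintro i j (t | k) hj hk
      · linarith [hl1 i t, hr0 i j hj]
      · exact absurd rfl (hk k))
    (fun v => match v with
      | Sum.inl t => c fun i => (t.1 i : ℕ)
      | Sum.inr j => j) (fun i => rfl)
  let C : Finset I := Finset.univ.filter fun i => Sum.inr i ∉ R
  -- no lattice point exceeds the minimum of `R` in all the coordinates of `C`
  have key : ∀ y : I → ℕ, ∑ i, y i = N → ∃ i ∈ C, ∀ t : T, Sum.inl t ∈ R → y i ≤ t.1 i := by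
    intro y hy
    obtain ⟨s, hs⟩ := mkT y hy
    obtain ⟨i, hi⟩ := hdom (Sum.inl s)
    refine ⟨i, ?_, fun t ht => ?_⟩
    · simp only [C, Finset.mem_filter, Finset.mem_univ, true_and]
      intro h
      have := hi _ h
      linarith [hrs i, hl0 i s]
    · rw [← hs]; exact hlt i s t (hi _ ht)
  obtain ⟨i₁⟩ := ‹Nonempty I›
  have hCne : C.Nonempty := by
    obtain ⟨i, hi, -⟩ := key (Pi.single i₁ N) (by simp)
    exact ⟨i, hi⟩
  have hRT : ∃ t : T, Sum.inl t ∈ R := by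
    by_contra! hcon
    obtain ⟨i, hi⟩ := hCne
    have hsub : R ⊆ (Finset.univ.erase i).image Sum.inr := by
      rintro (t | k) h
      · exact absurd h (hcon t)
      · refine Finset.mem_image_of_mem _ (Finset.mem_erase.2 ⟨?_, Finset.mem_univ _⟩)
        rintro rfl
        exact (Finset.mem_filter.1 hi).2 h
    have h1 := Finset.card_le_card hsub
    have h2 := Finset.card_image_le (s := Finset.univ.erase i) (f := (Sum.inr : I → T ⊕ I))
    have h3 := Finset.card_erase_add_one (Finset.mem_univ i)
    rw [Finset.card_univ] at h3
    omega
  obtain ⟨t₀, ht₀⟩ := hRT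
  have hmin : ∀ i, ∃ m : ℕ, (∀ t : T, Sum.inl t ∈ R → m ≤ t.1 i) ∧
      ∃ t : T, Sum.inl t ∈ R ∧ (t.1 i : ℕ) = m := by
    intro i
    obtain ⟨t, ht, htm⟩ := Finset.exists_min_image
      (Finset.univ.filter fun t : T => Sum.inl t ∈ R) (fun t => (t.1 i : ℕ)) ⟨t₀, by simpa using ht₀⟩
    exact ⟨t.1 i, fun t' ht' => htm t' (by simpa using ht'), t, by simpa using ht, rfl⟩
  choose m hm hm' using hmin
  -- otherwise the minimum of `R` could be raised by one in every coordinate of `C` and completed to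
  -- a lattice point
  have hsum : N < ∑ i ∈ C, (m i + 1) := by
    by_contra! hcon
    obtain ⟨j, hj⟩ := hCne
    let y : I → ℕ := fun i => (if i ∈ C then m i + 1 else 0) +
      Pi.single (M := fun _ => ℕ) j (N - ∑ i ∈ C, (m i + 1)) i
    have hy : ∑ i, y i = N := by
      simp only [y, Finset.sum_add_distrib, ← Finset.sum_filter, Finset.filter_univ_mem,
        Finset.sum_pi_single', Finset.mem_univ, if_true] at hcon ⊢
      omega
    obtain ⟨i, hi, hle⟩ := key y hy
    obtain ⟨t, ht, htm⟩ := hm' i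
    have h1 := hle t ht
    simp only [y, if_pos hi] at h1
    omega
  have hsum' : N < ∑ i ∈ C, m i + Fintype.card I := by
    rw [Finset.sum_add_distrib, Finset.sum_const, smul_eq_mul, mul_one] at hsum
    have := Finset.card_le_univ C
    omega
  have hsplit : ∀ t : T, Sum.inl t ∈ R → ∀ i,
      (i ∈ C → (t.1 i : ℕ) ≤ m i + Fintype.card I) ∧ (i ∉ C → (t.1 i : ℕ) ≤ Fintype.card I) := by
    intro t ht i
    have hle : ∀ j ∈ C, m j ≤ t.1 j := fun j _ => hm j t ht
    constructor
    · intro hi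
      have h1 := Finset.add_sum_erase C (fun j => m j) hi
      have h2 := Finset.add_sum_erase C (fun j => (t.1 j : ℕ)) hi
      have h3 : ∑ j ∈ C.erase i, m j ≤ ∑ j ∈ C.erase i, (t.1 j : ℕ) :=
        Finset.sum_le_sum fun j hj => hle j (Finset.mem_of_mem_erase hj)
      have h4 : ∑ j ∈ C, (t.1 j : ℕ) ≤ ∑ j, (t.1 j : ℕ) :=
        Finset.sum_le_sum_of_subset (Finset.subset_univ _)
      have h5 := t.2
      omega
    · intro hi
      have h3 : ∑ j ∈ C, m j ≤ ∑ j ∈ C, (t.1 j : ℕ) := Finset.sum_le_sum hle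
      have h4 : ∑ j ∈ insert i C, (t.1 j : ℕ) ≤ ∑ j, (t.1 j : ℕ) :=
        Finset.sum_le_sum_of_subset (Finset.subset_univ _)
      rw [Finset.sum_insert hi] at h4
      have h5 := t.2
      omega
  refine ⟨(Finset.univ.filter fun t : T => Sum.inl t ∈ R).image fun t i => (t.1 i : ℕ),
    ⟨_, Finset.mem_image_of_mem _ (by simpa using ht₀)⟩, ?_, ?_, ?_⟩
  · intro x hx
    obtain ⟨t, -, rfl⟩ := Finset.mem_image.1 hx
    exact t.2
  · intro x hx y hy i
    obtain ⟨s, hs, rfl⟩ := Finset.mem_image.1 hx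
    obtain ⟨t, ht, rfl⟩ := Finset.mem_image.1 hy
    simp only [Finset.mem_filter, Finset.mem_univ, true_and] at hs ht
    by_cases hi : i ∈ C
    · have h1 := (hsplit s hs i).1 hi
      have h2 := hm i t ht
      simp only; omega
    · have h1 := (hsplit s hs i).2 hi
      simp only; omega
  · intro i
    by_cases hi : i ∈ C
    · left
      have : i ∈ R.image _ := hRcol.symm ▸ Finset.mem_univ i
      obtain ⟨v, hv, hvi⟩ := Finset.mem_image.1 this
      rcases v with t | k
      · exact ⟨_, Finset.mem_image_of_mem _ (by simpa using hv), hvi⟩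
      · simp only at hvi
        subst hvi
        exact absurd hv (Finset.mem_filter.1 hi).2
    · right
      intro x hx
      obtain ⟨t, ht, rfl⟩ := Finset.mem_image.1 hx
      exact (hsplit t (by simpa using ht) i).2 hi

end Scarf

/-! ### Brouwer's theorem and variational inequalities -/

open Set in
/-- **Brouwer's fixed point theorem** for the standard simplex. -/
theorem exists_fixedPoint_stdSimplex {I : Type*} [Fintype I] [Nonempty I]
    {f : (I → ℝ) → I → ℝ} (hf : ContinuousOn f (stdSimplex ℝ I))
    (hmaps : MapsTo f (stdSimplex ℝ I) (stdSimplex ℝ I)) :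
    ∃ x ∈ stdSimplex ℝ I, f x = x := by
  classical
  have hcomp : IsCompact (stdSimplex ℝ I) := isCompact_stdSimplex ℝ I
  have happrox : ∀ ε > 0, ∃ x ∈ stdSimplex ℝ I, ∀ i, x i ≤ f x i + ε := by
    intro ε hε
    obtain ⟨δ, hδ, hfδ⟩ := Metric.uniformContinuousOn_iff.1
      (hcomp.uniformContinuousOn_of_continuous hf) (ε / 2) (by positivity)
    obtain ⟨N, hN⟩ := exists_nat_gt ((Fintype.card I : ℝ) / min δ (ε / 2))
    have hmin : 0 < min δ (ε / 2) := lt_min hδ (by positivity)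
    have hcard : (0 : ℝ) < Fintype.card I := by exact_mod_cast Fintype.card_pos
    have hN0 : (0 : ℝ) < N := lt_trans (by positivity) hN
    have hstep : (Fintype.card I : ℝ) / N < min δ (ε / 2) := by
      rw [div_lt_iff₀ hmin] at hN
      rw [div_lt_iff₀ hN0]; linarith
    let p : (I → ℕ) → I → ℝ := fun x i => x i / N
    have hp : ∀ x : I → ℕ, ∑ i, x i = N → p x ∈ stdSimplex ℝ I := by
      intro x hx
      refine ⟨fun i => by positivity, ?_⟩
      simp only [p]
      rw [← Finset.sum_div, ← Nat.cast_sum, hx, div_self hN0.ne']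
    -- colour a point by a coordinate that `f` does not decrease
    have hcol : ∀ x : I → ℕ, ∃ i, ∑ i, x i = N → p x i ≤ f (p x) i := by
      intro x
      by_cases hx : ∑ i, x i = N
      · obtain ⟨i, -, hi⟩ := Finset.exists_le_of_sum_le (s := Finset.univ) (f := p x)
          (g := f (p x)) Finset.univ_nonempty
          (by rw [(hp x hx).2, (hmaps (hp x hx)).2])
        exact ⟨i, fun _ => hi⟩
      · exact ⟨Classical.arbitrary I, fun h => absurd h hx⟩
    choose c hc using hcol
    obtain ⟨R, ⟨x, hx⟩, hRsum, hRdiam, hRcol⟩ := Scarf.exists_close_lattice_points N c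
    have hdist : ∀ y ∈ R, ∀ z ∈ R, ∀ i, p y i ≤ p z i + Fintype.card I / N := by
      intro y hy z hz i
      simp only [p]
      rw [← add_div, div_le_div_iff_of_pos_right hN0]
      exact_mod_cast hRdiam y hy z hz i
    refine ⟨p x, hp x (hRsum x hx), fun i => ?_⟩
    have hsm := min_le_right δ (ε / 2)
    rcases hRcol i with ⟨z, hz, hzi⟩ | h
    · have hzx : dist (p z) (p x) < δ := by
        rw [dist_pi_lt_iff hδ]
        intro j
        refine lt_of_le_of_lt ?_ (hstep.trans_le (min_le_left _ _))
        rw [Real.dist_eq, abs_le]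
        constructor <;> linarith [hdist z hz x hx j, hdist x hx z hz j]
      have h1 := hfδ _ (hp z (hRsum z hz)) _ (hp x (hRsum x hx)) hzx
      have h2 := (dist_le_pi_dist (f (p z)) (f (p x)) i).trans_lt h1
      rw [Real.dist_eq, abs_lt] at h2
      have h3 := hc z (hRsum z hz)
      rw [hzi] at h3
      linarith [hdist x hx z hz i]
    · have h1 : p x i ≤ Fintype.card I / N := by
        simp only [p]
        rw [div_le_div_iff_of_pos_right hN0]
        exact_mod_cast h x hx
      have h2 := (hmaps (hp x (hRsum x hx))).1 i
      linarith
  -- approximate solutions of `x ≤ f x` give an exact one, and then equality as both sums are one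
  let g : (I → ℝ) → ℝ := fun x => ∑ i, max 0 (x i - f x i)
  have hg : ContinuousOn g (stdSimplex ℝ I) := by
    refine continuousOn_finsetSum _ fun i _ => ?_
    exact continuousOn_const.sup ((continuous_apply i).continuousOn.sub
      ((continuous_apply i).comp_continuousOn hf))
  obtain ⟨x, hx, hxmin⟩ := hcomp.exists_isMinOn
    ((happrox 1 one_pos).imp fun _ h => h.1) hg
  have hg0 : g x ≤ 0 := by
    refine le_of_forall_pos_le_add fun ε hε => ?_
    have hcard : (0 : ℝ) < Fintype.card I := by exact_mod_cast Fintype.card_pos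
    obtain ⟨y, hy, hyε⟩ := happrox (ε / Fintype.card I) (by positivity)
    calc g x ≤ g y := hxmin hy
      _ ≤ ∑ i : I, ε / Fintype.card I := Finset.sum_le_sum fun i _ =>
          max_le (by positivity) (by linarith [hyε i])
      _ = 0 + ε := by
          rw [Finset.sum_const, Finset.card_univ, nsmul_eq_mul]; field_simp; simp
  refine ⟨x, hx, ?_⟩
  have hle : ∀ i, x i ≤ f x i := by
    intro i
    have h1 := Finset.single_le_sum (f := fun i => max 0 (x i - f x i))
      (fun j _ => le_max_left _ _) (Finset.mem_univ i)
    have h2 := le_max_right 0 (x i - f x i)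
    simp only [g] at hg0
    linarith
  have hsum : ∑ i, x i = ∑ i, f x i := by rw [hx.2, (hmaps hx).2]
  funext i
  exact ((Finset.sum_eq_sum_iff_of_le fun i _ => hle i).1 hsum i (Finset.mem_univ i)).symm

open Set in
/-- The **Hartman–Stampacchia theorem**: a variational inequality over a nonempty compact convex set
has a solution if it depends continuously on the base point. By compactness, finitely many test
points `z i` suffice, and for these a solution is given by a fixed point of Nash's map, which shifts
weight to the `z i` at which the inequality fails. -/
theorem exists_variationalInequality_solution {E : Type*} [AddCommGroup E] [Module ℝ E]
    [TopologicalSpace E] [IsTopologicalAddGroup E] [ContinuousSMul ℝ E]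
    {C : Set E} (hC : IsCompact C) (hconv : Convex ℝ C) (hne : C.Nonempty) (ℓ : E → E →ₗ[ℝ] ℝ)
    (hℓ : ∀ z ∈ C, ContinuousOn (fun x => ℓ x (z - x)) C) :
    ∃ x ∈ C, ∀ z ∈ C, 0 ≤ ℓ x (z - x) := by
  classical
  let B : E → E → ℝ := fun x z => ℓ x (z - x)
  have hB : ∀ z ∈ C, ContinuousOn (fun x => B x z) C := hℓ
  have hfin : ∀ u : Finset C, ∃ x ∈ C, ∀ z ∈ u, 0 ≤ B x z := by
    intro u
    rcases u.eq_empty_or_nonempty with rfl | ⟨z₀, hz₀⟩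
    · obtain ⟨x, hx⟩ := hne
      exact ⟨x, hx, by simp⟩
    have : Nonempty u := ⟨⟨z₀, hz₀⟩⟩
    let X : (u → ℝ) → E := fun t => ∑ i, t i • (i : C).1
    have hX : Continuous X := continuous_finsetSum _ fun i _ =>
      (continuous_apply i).smul continuous_const
    have hXC : MapsTo X (stdSimplex ℝ u) C := fun t ht =>
      hconv.sum_mem (fun i _ => ht.1 i) ht.2 fun i _ => i.1.2
    let φ : (u → ℝ) → u → ℝ := fun t i => max 0 (-B (X t) (i : C))
    have hφ0 : ∀ t i, 0 ≤ φ t i := fun t i => le_max_left _ _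
    have hφ : ∀ i, ContinuousOn (fun t => φ t i) (stdSimplex ℝ u) := fun i =>
      continuousOn_const.sup ((hB _ i.1.2).comp hX.continuousOn hXC).neg
    have hφs : ContinuousOn (fun t => 1 + ∑ j, φ t j) (stdSimplex ℝ u) :=
      continuousOn_const.add (continuousOn_finsetSum _ fun i _ => hφ i)
    have hpos : ∀ t, 0 < 1 + ∑ j, φ t j := fun t =>
      add_pos_of_pos_of_nonneg one_pos (Finset.sum_nonneg fun j _ => hφ0 t j)
    obtain ⟨t, ht, hfix⟩ := exists_fixedPoint_stdSimplex
      (f := fun t i => (t i + φ t i) / (1 + ∑ j, φ t j))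
      (continuousOn_pi.2 fun i => ((continuous_apply i).continuousOn.add (hφ i)).div hφs
        fun t _ => (hpos t).ne')
      (fun t ht => ⟨fun i => div_nonneg (add_nonneg (ht.1 i) (hφ0 t i)) (hpos t).le, by
        rw [← Finset.sum_div, Finset.sum_add_distrib, ht.2, div_self (hpos t).ne']⟩)
    have hfix' : ∀ i, φ t i = t i * ∑ j, φ t j := by
      intro i
      have h := congrFun hfix i
      rw [div_eq_iff (hpos t).ne'] at h
      linarith
    have hsum0 : ∑ j, φ t j = 0 := by
      by_contra hne0
      have hs : 0 < ∑ j, φ t j :=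
        lt_of_le_of_ne (Finset.sum_nonneg fun j _ => hφ0 t j) (Ne.symm hne0)
      have haff : ∑ i, t i * B (X t) (i : C) = 0 := by
        have h1 : ∑ i, t i • ((i : C).1 - X t) = 0 := by
          simp only [smul_sub, Finset.sum_sub_distrib]
          rw [← Finset.sum_smul, ht.2, one_smul, sub_self]
        have h2 := congrArg (ℓ (X t)) h1
        simpa [B] using h2
      have hneg : ∀ i, 0 < t i → B (X t) (i : C) < 0 := by
        intro i hi
        have h1 : 0 < φ t i := by rw [hfix']; positivity
        simp only [φ, lt_max_iff, lt_irrefl, false_or] at h1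
        linarith
      obtain ⟨i, -, hi⟩ := Finset.exists_lt_of_sum_lt (s := (Finset.univ : Finset u))
        (f := fun _ => (0 : ℝ)) (g := t) (by rw [ht.2]; simp)
      have : ∑ i, t i * B (X t) (i : C) < 0 := by
        refine Finset.sum_neg' (fun j _ => ?_)
          ⟨i, Finset.mem_univ i, mul_neg_of_pos_of_neg hi (hneg i hi)⟩
        rcases (ht.1 j).eq_or_lt with h | h
        · simp [← h]
        · exact (mul_neg_of_pos_of_neg h (hneg j h)).le
      exact this.ne haff
    refine ⟨X t, hXC ht, fun z hz => ?_⟩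
    have h1 : φ t ⟨z, hz⟩ = 0 :=
      (Finset.sum_eq_zero_iff_of_nonneg fun j _ => hφ0 t j).1 hsum0 _ (Finset.mem_univ _)
    have h2 := le_max_right 0 (-B (X t) (z : C))
    simp only [φ] at h1
    linarith
  by_contra! hcon
  change ∀ x ∈ C, ∃ z ∈ C, B x z < 0 at hcon
  -- the open sets on which a given test point violates the inequality cover `C`
  have hopen : ∀ x ∈ C, ∃ z : C, {y | B y z < 0} ∈ nhdsWithin x C := by
    intro x hx
    obtain ⟨z, hz, hlt⟩ := hcon x hx
    exact ⟨⟨z, hz⟩, (hB z hz x hx).eventually (gt_mem_nhds hlt)⟩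
  have : Nonempty C := hne.to_subtype
  choose! Z hZ using hopen
  obtain ⟨s, hsC, hs⟩ := hC.elim_nhdsWithin_subcover (fun x => {y | B y (Z x) < 0}) hZ
  obtain ⟨x, hxC, hx⟩ := hfin (s.image Z)
  obtain ⟨y, hy, hxy⟩ := mem_iUnion₂.1 (hs hxC)
  exact absurd hxy (not_lt.2 (hx (Z y) (Finset.mem_image_of_mem _ hy)))

/-! ### Log-determinants and positive semidefinite matrices -/

namespace SecrecyGame

section Matrices

-- any norm would do: all of them induce the entrywise topology that `HasMatrixGradientAt` uses
attribute [local instance] Matrix.normedAddCommGroup Matrix.normedSpace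

variable {n m : ℕ}

theorem det_re_pos {A : CMat n} (hA : A.PosDef) : 0 < A.det.re ∧ A.det.im = 0 := by
  have h := Complex.lt_def.1 hA.det_pos
  exact ⟨by simpa using h.1, by simpa using h.2.symm⟩

theorem lnDet_inv {A : CMat n} (hA : A.PosDef) : lnDet A⁻¹ = -lnDet A := by
  have h := (det_re_pos hA).2
  have hd : A.det = (A.det.re : ℂ) := Complex.ext rfl (by simp [h])
  rw [lnDet, lnDet, Matrix.det_nonsing_inv, Ring.inverse_eq_inv', hd, ← Complex.ofReal_inv,
    Complex.ofReal_re, Complex.ofReal_re, Real.log_inv]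

/-- The inequality `ln |S| + ln |M| ≤ tr (S M) - n`, which is `ln x ≤ x - 1` for the eigenvalues
of a Hermitian matrix similar to `S M`. It is an equality for `S = M⁻¹`. -/
theorem lnDet_add_lnDet_le {S M : CMat n} (hS : S.PosDef) (hM : M.PosDef) :
    lnDet S + lnDet M ≤ (S * M).trace.re - n := by
  obtain ⟨Y, hY⟩ : ∃ Y : CMat n, M = Yᴴ * Y := by
    open scoped MatrixOrder in
    exact CStarAlgebra.nonneg_iff_eq_star_mul_self.mp hM.posSemidef.nonneg
  have hA : (Y * S * Yᴴ).PosSemidef := hS.posSemidef.mul_mul_conjTranspose_same Y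
  have hdet : (Y * S * Yᴴ).det = S.det * M.det := by
    rw [hY]; simp only [Matrix.det_mul]; ring
  have htr : (Y * S * Yᴴ).trace = (S * M).trace := by
    rw [hY, Matrix.mul_assoc, Matrix.trace_mul_comm, Matrix.mul_assoc]
  have hprod : ∏ i, hA.1.eigenvalues i = S.det.re * M.det.re := by
    have h := hA.1.det_eq_prod_eigenvalues
    rw [hdet] at h
    have h' := congrArg Complex.re h
    rw [Complex.mul_re, (det_re_pos hS).2, zero_mul, sub_zero] at h'
    rw [h']
    simp [← Complex.ofReal_prod]
  have hpos : ∀ i, 0 < hA.1.eigenvalues i := by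
    intro i
    refine lt_of_le_of_ne (hA.eigenvalues_nonneg i) fun h => ?_
    have h0 : ∏ i, hA.1.eigenvalues i = 0 := Finset.prod_eq_zero (Finset.mem_univ i) h.symm
    rw [hprod] at h0
    exact (mul_pos (det_re_pos hS).1 (det_re_pos hM).1).ne' h0
  have hsum : ∑ i, hA.1.eigenvalues i = (S * M).trace.re := by
    rw [← htr, hA.1.trace_eq_sum_eigenvalues]
    simp [← Complex.ofReal_sum]
  rw [lnDet, lnDet, ← Real.log_mul (det_re_pos hS).1.ne' (det_re_pos hM).1.ne', ← hprod, ← hsum,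
    Real.log_prod fun i _ => (hpos i).ne']
  calc ∑ i, Real.log (hA.1.eigenvalues i) ≤ ∑ i, (hA.1.eigenvalues i - 1) :=
        Finset.sum_le_sum fun i _ => Real.log_le_sub_one_of_pos (hpos i)
    _ = ∑ i, hA.1.eigenvalues i - n := by simp

/-- The real linear functional `D ↦ Re tr (Y D)`. -/
noncomputable def traceMulCLM (Y : CMat n) : CMat n →L[ℝ] ℝ :=
  LinearMap.toContinuousLinearMap
    { toFun := fun D => (Y * D).trace.re
      map_add' := fun A B => by simp [Matrix.mul_add]
      map_smul' := fun c A => by simp }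

/-- The real linear map `D ↦ A D Aᴴ`. -/
noncomputable def conjCLM (A : Matrix (Fin m) (Fin n) ℂ) : CMat n →L[ℝ] CMat m :=
  LinearMap.toContinuousLinearMap
    { toFun := fun D => A * D * Aᴴ
      map_add' := fun D E => by simp [Matrix.mul_add, Matrix.add_mul]
      map_smul' := fun c D => by simp }

theorem conjCLM_apply (A : Matrix (Fin m) (Fin n) ℂ) (D : CMat n) :
    conjCLM A D = A * D * Aᴴ := rfl

theorem differentiable_det : Differentiable ℂ (fun A : CMat n => A.det) := by
  have hentry : ∀ i j, Differentiable ℂ (fun A : CMat n => A i j) := fun i j =>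
    (LinearMap.toContinuousLinearMap (Matrix.entryLinearMap ℂ ℂ i j)).differentiable
  simp only [Matrix.det_apply, Units.smul_def, zsmul_eq_mul]
  refine Differentiable.fun_sum fun σ _ => (differentiable_const _).mul fun A => ?_
  exact (HasFDerivAt.finsetProd (g := fun i (A : CMat n) => A (σ i) i)
    fun i _ => (hentry _ _ A).hasFDerivAt).differentiableAt

/-- Jacobi's formula: the differential of `ln |A|` at `M` is `D ↦ Re tr (M⁻¹ D)`. -/
theorem hasFDerivAt_lnDet {M : CMat n} (hM : M.PosDef) :
    HasFDerivAt lnDet (traceMulCLM M⁻¹) M := by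
  have hunit : IsUnit M.det := isUnit_iff_ne_zero.2 hM.det_pos.ne'
  have hfd := (differentiable_det (n := n) M).hasFDerivAt
  -- the differential is read off along lines, where the determinant is a polynomial
  have hline : ∀ D : CMat n, fderiv ℂ (fun A : CMat n => A.det) M D
      = M.det * (M⁻¹ * D).trace := by
    intro D
    have h1 : HasDerivAt (fun t : ℂ => (M + t • D).det)
        (fderiv ℂ (fun A : CMat n => A.det) M D) 0 := by
      have hl : HasDerivAt (fun t : ℂ => M + t • D) D 0 := by
        have h := ((hasDerivAt_id (0 : ℂ)).smul_const D).const_add M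
        rw [one_smul] at h
        exact h
      exact HasFDerivAt.comp_hasDerivAt_of_eq (0 : ℂ) hfd hl (by simp)
    have h2 : (fun t : ℂ => (M + t • D).det) = fun t : ℂ => M.det * (1 + (M⁻¹ * D).trace * t +
        (Matrix.det (1 + (Polynomial.X : Polynomial ℂ) •
          (M⁻¹ * D).map Polynomial.C)).divX.divX.eval t * t ^ 2) := by
      funext t
      rw [← Matrix.det_one_add_smul, ← Matrix.det_mul, Matrix.mul_add, Matrix.mul_one,
        Matrix.mul_smul, Matrix.mul_nonsing_inv_cancel_left _ _ hunit]
    rw [h2] at h1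
    refine h1.unique ?_
    have h3 := ((((hasDerivAt_id (0 : ℂ)).const_mul (M⁻¹ * D).trace).const_add 1).add
      (((Matrix.det (1 + (Polynomial.X : Polynomial ℂ) •
          (M⁻¹ * D).map Polynomial.C)).divX.divX.hasDerivAt 0).mul
        ((hasDerivAt_id (0 : ℂ)).pow 2))).const_mul M.det
    simpa using h3
  have hre : HasFDerivAt (fun A : CMat n => A.det.re)
      (Complex.reCLM.comp ((fderiv ℂ (fun A : CMat n => A.det) M).restrictScalars ℝ)) M :=
    Complex.reCLM.hasFDerivAt.comp M (hfd.restrictScalars ℝ)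
  have hlog := hre.log (det_re_pos hM).1.ne'
  refine hlog.congr_fderiv ?_
  ext D
  change M.det.re⁻¹ * (fderiv ℂ (fun A : CMat n => A.det) M D).re = (M⁻¹ * D).trace.re
  rw [hline, Complex.mul_re, (det_re_pos hM).2, zero_mul, sub_zero,
    inv_mul_cancel_left₀ (det_re_pos hM).1.ne']

/-- The pairs of positive semidefinite matrices of bounded total trace form a compact set, as the
image of a bounded closed set of pairs `(A, B)` under `(A, B) ↦ (Aᴴ A, Bᴴ B)`. -/
theorem isCompact_posSemidef_pairs (P : ℝ) :
    IsCompact {p : CMat n × CMat n |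
      p.1.PosSemidef ∧ p.2.PosSemidef ∧ (p.1 + p.2).trace.re ≤ P} := by
  have hcont : Continuous fun p : CMat n × CMat n => (p.1ᴴ * p.1, p.2ᴴ * p.2) := by fun_prop
  have hnorm : ∀ A : CMat n, (Aᴴ * A).trace.re = ∑ j, ∑ i, ‖A i j‖ ^ 2 := by
    intro A
    simp only [Matrix.trace, Matrix.diag_apply, Matrix.mul_apply, Matrix.conjTranspose_apply,
      Complex.re_sum]
    refine Finset.sum_congr rfl fun j _ => Finset.sum_congr rfl fun i _ => ?_
    rw [Complex.star_def, ← Complex.normSq_eq_conj_mul_self, Complex.ofReal_re,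
      Complex.normSq_eq_norm_sq]
  have hentry : ∀ (A : CMat n) i j, ‖A i j‖ ^ 2 ≤ (Aᴴ * A).trace.re := by
    intro A i j
    rw [hnorm]
    refine (Finset.single_le_sum (f := fun i => ‖A i j‖ ^ 2) (fun _ _ => by positivity)
      (Finset.mem_univ i)).trans ?_
    exact Finset.single_le_sum (f := fun j => ∑ i, ‖A i j‖ ^ 2) (fun _ _ => by positivity)
      (Finset.mem_univ j)
  have hnonneg : ∀ A : CMat n, 0 ≤ (Aᴴ * A).trace.re := fun A => by rw [hnorm]; positivity
  have hK : IsCompact {p : CMat n × CMat n | (p.1ᴴ * p.1 + p.2ᴴ * p.2).trace.re ≤ P} := by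
    refine Metric.isCompact_of_isClosed_isBounded
      (isClosed_le (by fun_prop) continuous_const) ?_
    refine (Metric.isBounded_closedBall (x := (0 : CMat n × CMat n)) (r := √P)).subset ?_
    intro p hp
    rw [Set.mem_ofPred_eq, Matrix.trace_add, Complex.add_re] at hp
    have h1 := hnonneg p.1
    have h2 := hnonneg p.2
    rw [mem_closedBall_zero_iff, Prod.norm_def, max_le_iff,
      Matrix.norm_le_iff (Real.sqrt_nonneg _), Matrix.norm_le_iff (Real.sqrt_nonneg _)]
    constructor <;> intro i j <;> apply Real.le_sqrt_of_sq_le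
    · linarith [hentry p.1 i j]
    · linarith [hentry p.2 i j]
  convert! hK.image hcont using 1
  ext ⟨A, B⟩
  constructor
  · rintro ⟨hA, hB, htr⟩
    have hfac : ∀ {A : CMat n}, A.PosSemidef → ∃ Y : CMat n, A = Yᴴ * Y := fun h => by
      open scoped MatrixOrder in
      exact CStarAlgebra.nonneg_iff_eq_star_mul_self.mp h.nonneg
    obtain ⟨Y, rfl⟩ := hfac hA
    obtain ⟨Z, rfl⟩ := hfac hB
    exact ⟨(Y, Z), htr, rfl⟩
  · rintro ⟨⟨Y, Z⟩, htr, h⟩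
    obtain ⟨rfl, rfl⟩ := Prod.mk.inj h
    exact ⟨Matrix.posSemidef_conjTranspose_mul_self Y,
      Matrix.posSemidef_conjTranspose_mul_self Z, htr⟩

end Matrices

theorem continuousAt_lnDet {n : ℕ} {M : CMat n} (hM : M.PosDef) : ContinuousAt lnDet M :=
  (hasFDerivAt_lnDet hM).continuousAt

theorem continuousAt_inv {n : ℕ} {M : CMat n} (hM : M.PosDef) :
    ContinuousAt (fun A : CMat n => A⁻¹) M := by
  refine continuousAt_matrix_inv M ?_
  rw [Ring.inverse_eq_inv']
  exact continuousAt_inv₀ hM.det_pos.ne'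

end SecrecyGame

namespace SecrecyGame

/-! ### The smooth maximum -/

section LogSumExp

variable {E : Type*} [NormedAddCommGroup E] [NormedSpace ℝ E] {K : ℕ}

/-- The weights `exp (β a_k) / ∑_j exp (β a_j)`, which form the gradient of the smooth maximum
`(1/β) ln (∑_k exp (β a_k))`. -/
noncomputable def softmax (β : ℝ) (a : Fin K → ℝ) (k : Fin K) : ℝ :=
  Real.exp (β * a k) / ∑ j, Real.exp (β * a j)

/-- The case `K = 0`, where the sum is empty and its logarithm is the junk value `0`, is
included. -/
theorem hasFDerivAt_smoothMax {β : ℝ} (hβ : 0 < β) {a : E → Fin K → ℝ} {a' : Fin K → E →L[ℝ] ℝ}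
    {x : E} (ha : ∀ k, HasFDerivAt (fun y => a y k) (a' k) x) :
    HasFDerivAt (fun y => 1 / β * Real.log (∑ k, Real.exp (β * a y k)))
      (∑ k, softmax β (a x) k • a' k) x := by
  rcases isEmpty_or_nonempty (Fin K) with h | h
  · simpa using hasFDerivAt_const (𝕜 := ℝ) (0 : ℝ) x
  have hpos : 0 < ∑ k, Real.exp (β * a x k) :=
    Finset.sum_pos (fun k _ => Real.exp_pos _) Finset.univ_nonempty
  have h1 : HasFDerivAt (fun y => ∑ k, Real.exp (β * a y k))
      (∑ k, Real.exp (β * a x k) • (β • a' k)) x :=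
    HasFDerivAt.fun_sum fun k _ => ((ha k).const_mul β).exp
  refine ((h1.log hpos.ne').const_mul (1 / β)).congr_fderiv ?_
  rw [Finset.smul_sum, Finset.smul_sum]
  refine Finset.sum_congr rfl fun k _ => ?_
  rw [smul_smul, smul_smul, smul_smul, softmax]
  congr 1
  field_simp

end LogSumExp

namespace Network

variable {Q K : ℕ} (N : Network Q K)

/-! ### The optimal auxiliary matrices -/

/-- The covariance `M_q + H_qq Σ_q H_qqᴴ` of everything that receiver `q` receives. -/
noncomputable def rxTotal (q : Fin Q) (X : N.Profile) : CMat (N.NR q) :=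
  N.rxCov q X + N.H q q * (X q).1 * (N.H q q)ᴴ

/-- The covariance `M_{e,q,k} + G_qk Σ_q G_qkᴴ` of everything that eavesdropper `k` receives. -/
noncomputable def eveTotal (q : Fin Q) (k : Fin K) (X : N.Profile) : CMat (N.Ne k) :=
  N.eveCov q k X + N.G q k * (X q).1 * (N.G q k)ᴴ

/-- The best auxiliary matrices, `S_{q,0} = M_q⁻¹` and
`S_{q,k} = (M_{e,q,k} + G_qk Σ_q G_qkᴴ)⁻¹`. -/
noncomputable def optAux (q : Fin Q) (X : N.Profile) : N.Aux q :=
  ((N.rxCov q X)⁻¹, fun k => (N.eveTotal q k X)⁻¹)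

variable {N}

section PosDef

variable {X : N.Profile} (hX : X ∈ N.feasible)
include hX

theorem posDef_rxCov (q : Fin Q) : (N.rxCov q X).PosDef :=
  (Matrix.PosDef.one.add_posSemidef ((hX q).2.1.mul_mul_conjTranspose_same _)).add_posSemidef
    (Matrix.posSemidef_sum _ fun r _ =>
      ((hX r).1.add (hX r).2.1).mul_mul_conjTranspose_same _)

theorem posDef_eveCov (q : Fin Q) (k : Fin K) : (N.eveCov q k X).PosDef :=
  (Matrix.PosDef.one.add_posSemidef ((hX q).2.1.mul_mul_conjTranspose_same _)).add_posSemidef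
    (Matrix.posSemidef_sum _ fun r _ =>
      ((hX r).1.add (hX r).2.1).mul_mul_conjTranspose_same _)

theorem posDef_rxTotal (q : Fin Q) : (N.rxTotal q X).PosDef :=
  (posDef_rxCov hX q).add_posSemidef ((hX q).1.mul_mul_conjTranspose_same _)

theorem posDef_eveTotal (q : Fin Q) (k : Fin K) : (N.eveTotal q k X).PosDef :=
  (posDef_eveCov hX q k).add_posSemidef ((hX q).1.mul_mul_conjTranspose_same _)

theorem optAux_mem (q : Fin Q) : N.optAux q X ∈ N.auxSet q :=
  ⟨(posDef_rxCov hX q).inv, fun k => (posDef_eveTotal hX q k).inv⟩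

theorem phi_le_optAux (q : Fin Q) {S : CMat (N.NR q)} (hS : S.PosDef) :
    N.phi q X S ≤ N.phi q X (N.rxCov q X)⁻¹ := by
  have hM := posDef_rxCov hX q
  have h := lnDet_add_lnDet_le hS hM
  rw [phi, phi, lnDet_inv hM, Matrix.nonsing_inv_mul _ (isUnit_iff_ne_zero.2 hM.det_pos.ne'),
    Matrix.trace_one, Fintype.card_fin, Complex.natCast_re]
  linarith

theorem phiEve_optAux_le (q : Fin Q) (k : Fin K) {S : CMat (N.Ne k)} (hS : S.PosDef) :
    N.phiEve q k X (N.eveTotal q k X)⁻¹ ≤ N.phiEve q k X S := by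
  have hM := posDef_eveTotal hX q k
  have h := lnDet_add_lnDet_le hS hM
  rw [phiEve, phiEve, ← eveTotal, lnDet_inv hM,
    Matrix.nonsing_inv_mul _ (isUnit_iff_ne_zero.2 hM.det_pos.ne'),
    Matrix.trace_one, Fintype.card_fin, Complex.natCast_re]
  linarith

theorem isMaxOn_optAux {β : ℝ} (hβ : 0 < β) (q : Fin Q) :
    IsMaxOn (N.objective β q X) (N.auxSet q) (N.optAux q X) := by
  intro S hS
  refine sub_le_sub (phi_le_optAux hX q hS.1) (mul_le_mul_of_nonneg_left ?_ (by positivity))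
  rcases isEmpty_or_nonempty (Fin K) with h | h
  · simp
  refine Real.log_le_log (Finset.sum_pos (fun k _ => Real.exp_pos _) Finset.univ_nonempty)
    (Finset.sum_le_sum fun k _ => Real.exp_le_exp.2 (mul_le_mul_of_nonneg_left ?_ hβ.le))
  exact phiEve_optAux_le hX q k (hS.2 k)

end PosDef

/-! ### The gradient of the objective -/

theorem rxCov_update (q : Fin Q) (X : N.Profile) (p : N.Strategy q) :
    N.rxCov q (Function.update X q p)
      = N.rxCov q X + conjCLM (N.H q q) (p.2 - (X q).2) := by
  have h : ∀ r ∈ Finset.univ.erase q, Function.update X q p r = X r := fun r hr =>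
    Function.update_of_ne (Finset.ne_of_mem_erase hr) _ _
  rw [rxCov, rxCov, Finset.sum_congr rfl fun r hr => by rw [h r hr], Function.update_self,
    map_sub, conjCLM_apply, conjCLM_apply]
  abel

theorem eveCov_update (q : Fin Q) (k : Fin K) (X : N.Profile) (p : N.Strategy q) :
    N.eveCov q k (Function.update X q p)
      = N.eveCov q k X + conjCLM (N.G q k) (p.2 - (X q).2) := by
  have h : ∀ r ∈ Finset.univ.erase q, Function.update X q p r = X r := fun r hr =>
    Function.update_of_ne (Finset.ne_of_mem_erase hr) _ _
  rw [eveCov, eveCov, Finset.sum_congr rfl fun r hr => by rw [h r hr], Function.update_self,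
    map_sub, conjCLM_apply, conjCLM_apply]
  abel

variable (N) in
/-- The gradient of the objective of player `q` in its own pair of matrices. -/
noncomputable def grad (β : ℝ) (q : Fin Q) (X : N.Profile) (S : N.Aux q) : N.Strategy q :=
  ((N.H q q)ᴴ * (N.rxTotal q X)⁻¹ * N.H q q
      - ∑ k, softmax β (fun k => N.phiEve q k X (S.2 k)) k • ((N.G q k)ᴴ * S.2 k * N.G q k),
    (N.H q q)ᴴ * ((N.rxTotal q X)⁻¹ - S.1) * N.H q q
      - ∑ k, softmax β (fun k => N.phiEve q k X (S.2 k)) k •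
        ((N.G q k)ᴴ * (S.2 k - (N.eveCov q k X)⁻¹) * N.G q k))

theorem grad_mem_hermitianPairs (β : ℝ) (q : Fin Q) {X : N.Profile} (hX : X ∈ N.feasible)
    {S : N.Aux q} (hS : S ∈ N.auxSet q) : N.grad β q X S ∈ hermitianPairs (N.NT q) := by
  have hsum : ∀ A : ∀ k, CMat (N.Ne k), (∀ k, (A k).IsHermitian) → (∑ k,
      softmax β (fun k => N.phiEve q k X (S.2 k)) k • ((N.G q k)ᴴ * A k * N.G q k)).IsHermitian := by
    intro A hA
    rw [Matrix.IsHermitian, Matrix.conjTranspose_sum]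
    refine Finset.sum_congr rfl fun k _ => ?_
    rw [Matrix.conjTranspose_smul, star_trivial]
    exact congrArg _ (Matrix.isHermitian_conjTranspose_mul_mul _ (hA k))
  exact ⟨(Matrix.isHermitian_conjTranspose_mul_mul _ (posDef_rxTotal hX q).inv.1).sub
      (hsum _ fun k => (hS.2 k).1),
    (Matrix.isHermitian_conjTranspose_mul_mul _ ((posDef_rxTotal hX q).inv.1.sub hS.1.1)).sub
      (hsum _ fun k => (hS.2 k).1.sub (posDef_eveCov hX q k).inv.1)⟩

section Gradient

attribute [local instance] Matrix.normedAddCommGroup Matrix.normedSpace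

theorem hasFDerivAt_rxCov_update (q : Fin Q) (X : N.Profile) :
    HasFDerivAt (fun p => N.rxCov q (Function.update X q p))
      ((conjCLM (N.H q q)).comp (ContinuousLinearMap.snd ℝ _ _)) (X q) := by
  simp only [rxCov_update]
  exact ((conjCLM (N.H q q)).hasFDerivAt.comp (X q) (hasFDerivAt_snd.sub_const _)).const_add _

theorem hasFDerivAt_eveCov_update (q : Fin Q) (k : Fin K) (X : N.Profile) :
    HasFDerivAt (fun p => N.eveCov q k (Function.update X q p))
      ((conjCLM (N.G q k)).comp (ContinuousLinearMap.snd ℝ _ _)) (X q) := by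
  simp only [eveCov_update]
  exact ((conjCLM (N.G q k)).hasFDerivAt.comp (X q) (hasFDerivAt_snd.sub_const _)).const_add _

theorem hasFDerivAt_rxTotal_update (q : Fin Q) (X : N.Profile) :
    HasFDerivAt (fun p => N.rxTotal q (Function.update X q p))
      ((conjCLM (N.H q q)).comp (ContinuousLinearMap.snd ℝ _ _) +
        (conjCLM (N.H q q)).comp (ContinuousLinearMap.fst ℝ _ _)) (X q) := by
  simp only [rxTotal, Function.update_self]
  exact (hasFDerivAt_rxCov_update q X).add
    ((conjCLM (N.H q q)).hasFDerivAt.comp (X q) hasFDerivAt_fst)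

theorem hasFDerivAt_eveTotal_update (q : Fin Q) (k : Fin K) (X : N.Profile) :
    HasFDerivAt (fun p => N.eveTotal q k (Function.update X q p))
      ((conjCLM (N.G q k)).comp (ContinuousLinearMap.snd ℝ _ _) +
        (conjCLM (N.G q k)).comp (ContinuousLinearMap.fst ℝ _ _)) (X q) := by
  simp only [eveTotal, Function.update_self]
  exact (hasFDerivAt_eveCov_update q k X).add
    ((conjCLM (N.G q k)).hasFDerivAt.comp (X q) hasFDerivAt_fst)

theorem hasFDerivAt_phi_update (q : Fin Q) {X : N.Profile} (hX : X ∈ N.feasible)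
    (S : CMat (N.NR q)) :
    HasFDerivAt (fun p => N.phi q (Function.update X q p) S)
      (-(traceMulCLM S).comp ((conjCLM (N.H q q)).comp (ContinuousLinearMap.snd ℝ _ _)) +
        (traceMulCLM (N.rxTotal q X)⁻¹).comp
          ((conjCLM (N.H q q)).comp (ContinuousLinearMap.snd ℝ _ _) +
            (conjCLM (N.H q q)).comp (ContinuousLinearMap.fst ℝ _ _))) (X q) := by
  have h1 := (traceMulCLM S).hasFDerivAt.comp (X q) (hasFDerivAt_rxCov_update q X)
  have hT : HasFDerivAt lnDet (traceMulCLM (N.rxTotal q X)⁻¹)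
      (N.rxTotal q (Function.update X q (X q))) := by
    rw [Function.update_eq_self]; exact hasFDerivAt_lnDet (posDef_rxTotal hX q)
  have h2 := hT.comp (X q) (hasFDerivAt_rxTotal_update q X)
  exact ((h1.neg.add_const (lnDet S)).add_const (N.NR q : ℝ)).add h2

theorem hasFDerivAt_phiEve_update (q : Fin Q) (k : Fin K) {X : N.Profile} (hX : X ∈ N.feasible)
    (S : CMat (N.Ne k)) :
    HasFDerivAt (fun p => N.phiEve q k (Function.update X q p) S)
      ((traceMulCLM S).comp ((conjCLM (N.G q k)).comp (ContinuousLinearMap.snd ℝ _ _) +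
            (conjCLM (N.G q k)).comp (ContinuousLinearMap.fst ℝ _ _)) -
        (traceMulCLM (N.eveCov q k X)⁻¹).comp
          ((conjCLM (N.G q k)).comp (ContinuousLinearMap.snd ℝ _ _))) (X q) := by
  have h1 := (traceMulCLM S).hasFDerivAt.comp (X q) (hasFDerivAt_eveTotal_update q k X)
  have hT : HasFDerivAt lnDet (traceMulCLM (N.eveCov q k X)⁻¹)
      (N.eveCov q k (Function.update X q (X q))) := by
    rw [Function.update_eq_self]; exact hasFDerivAt_lnDet (posDef_eveCov hX q k)
  have h2 := hT.comp (X q) (hasFDerivAt_eveCov_update q k X)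
  exact ((h1.sub_const (lnDet S)).sub_const (N.Ne k : ℝ)).sub h2

theorem trace_mul_conj {n m : ℕ} (Y : CMat m) (A : Matrix (Fin m) (Fin n) ℂ) (D : CMat n) :
    (Y * (A * D * Aᴴ)).trace = (Aᴴ * Y * A * D).trace := by
  rw [← Matrix.mul_assoc, Matrix.trace_mul_comm]
  simp only [Matrix.mul_assoc]

theorem hasMatrixGradientAt_objective {β : ℝ} (hβ : 0 < β) (q : Fin Q) {X : N.Profile}
    (hX : X ∈ N.feasible) {S : N.Aux q} (hS : S ∈ N.auxSet q) :
    HasMatrixGradientAt (fun p => N.objective β q (Function.update X q p) S)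
      (N.grad β q X S) (X q) := by
  have hmem := grad_mem_hermitianPairs β q hX hS
  refine ⟨hmem, HasFDerivAt.hasFDerivWithinAt ?_⟩
  have h := (hasFDerivAt_phi_update q hX S.1).sub (hasFDerivAt_smoothMax hβ
    fun k => hasFDerivAt_phiEve_update q k hX (S.2 k))
  refine HasFDerivAt.congr_fderiv h ?_
  simp only [Function.update_eq_self]
  refine ContinuousLinearMap.ext fun d => ?_
  change _ = ((N.grad β q X S).1ᴴ * d.1).trace.re + ((N.grad β q X S).2ᴴ * d.2).trace.re
  rw [hmem.1.eq, hmem.2.eq]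
  simp only [grad, Matrix.sub_mul, Matrix.mul_sub, Finset.sum_mul, Matrix.trace_sub, Matrix.trace_sum,
    Complex.sub_re, Complex.re_sum, Matrix.smul_mul, Matrix.trace_smul, Complex.smul_re]
  change -(S.1 * (N.H q q * d.2 * (N.H q q)ᴴ)).trace.re +
    ((N.rxTotal q X)⁻¹ *
      (N.H q q * d.2 * (N.H q q)ᴴ + N.H q q * d.1 * (N.H q q)ᴴ)).trace.re -
    (∑ k, softmax β (fun k => N.phiEve q k X (S.2 k)) k • _ : _ →L[ℝ] ℝ) d = _
  rw [sum_apply]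
  have hk : ∀ k, (softmax β (fun k => N.phiEve q k X (S.2 k)) k •
      ((traceMulCLM (S.2 k)).comp ((conjCLM (N.G q k)).comp (ContinuousLinearMap.snd ℝ _ _) +
            (conjCLM (N.G q k)).comp (ContinuousLinearMap.fst ℝ _ _)) -
        (traceMulCLM (N.eveCov q k X)⁻¹).comp
          ((conjCLM (N.G q k)).comp (ContinuousLinearMap.snd ℝ _ _))) : _ →L[ℝ] ℝ) d =
      softmax β (fun k => N.phiEve q k X (S.2 k)) k *
        ((((N.G q k)ᴴ * S.2 k * N.G q k * d.2).trace.re +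
          ((N.G q k)ᴴ * S.2 k * N.G q k * d.1).trace.re) -
          ((N.G q k)ᴴ * (N.eveCov q k X)⁻¹ * N.G q k * d.2).trace.re) := by
    intro k
    simp only [← trace_mul_conj, ← Complex.add_re, ← Matrix.trace_add, ← Matrix.mul_add]
    rfl
  simp only [Matrix.mul_add, Matrix.trace_add, Complex.add_re, trace_mul_conj, smul_eq_mul]
  rw [Finset.sum_congr rfl fun k _ => hk k]
  simp only [mul_sub, mul_add, Finset.sum_sub_distrib, Finset.sum_add_distrib]
  ring

end Gradient

/-! ### Existence of an equilibrium -/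

theorem continuous_rxCov (q : Fin Q) : Continuous (N.rxCov q) := by
  unfold rxCov; fun_prop

theorem continuous_eveCov (q : Fin Q) (k : Fin K) : Continuous (N.eveCov q k) := by
  unfold eveCov; fun_prop

theorem continuous_rxTotal (q : Fin Q) : Continuous (N.rxTotal q) :=
  (continuous_rxCov q).add (by fun_prop)

theorem continuous_eveTotal (q : Fin Q) (k : Fin K) : Continuous (N.eveTotal q k) :=
  (continuous_eveCov q k).add (by fun_prop)

theorem continuousOn_phiEve_optAux (q : Fin Q) (k : Fin K) :
    ContinuousOn (fun X => N.phiEve q k X ((N.optAux q X).2 k)) N.feasible := by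
  intro X hX
  have hinv : ContinuousAt (fun X => (N.eveTotal q k X)⁻¹) X :=
    (continuousAt_inv (posDef_eveTotal hX q k)).comp (continuous_eveTotal q k).continuousAt
  have h1 : ContinuousAt (fun X => ((N.eveTotal q k X)⁻¹ * N.eveTotal q k X).trace.re) X := by
    have h : Continuous fun p : CMat (N.Ne k) × CMat (N.Ne k) => (p.1 * p.2).trace.re := by
      fun_prop
    exact ContinuousAt.comp (g := fun p : CMat (N.Ne k) × CMat (N.Ne k) => (p.1 * p.2).trace.re)
      (f := fun X => ((N.eveTotal q k X)⁻¹, N.eveTotal q k X)) h.continuousAt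
      (hinv.prodMk (continuous_eveTotal q k).continuousAt)
  have h2 : ContinuousAt (fun X => lnDet (N.eveTotal q k X)⁻¹) X :=
    ContinuousAt.comp (g := lnDet) (continuousAt_lnDet (posDef_eveTotal hX q k).inv) hinv
  have h3 : ContinuousAt (fun X => lnDet (N.eveCov q k X)) X :=
    ContinuousAt.comp (g := lnDet) (continuousAt_lnDet (posDef_eveCov hX q k))
      (continuous_eveCov q k).continuousAt
  exact (((h1.sub h2).sub continuousAt_const).sub h3).continuousWithinAt

theorem continuousOn_softmax_optAux (β : ℝ) (q : Fin Q) (k : Fin K) :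
    ContinuousOn (fun X => softmax β (fun k => N.phiEve q k X ((N.optAux q X).2 k)) k)
      N.feasible := by
  have h : ∀ k, ContinuousOn
      (fun X => Real.exp (β * N.phiEve q k X ((N.optAux q X).2 k))) N.feasible := fun k =>
    Real.continuous_exp.comp_continuousOn
      (continuousOn_const.mul (continuousOn_phiEve_optAux q k))
  exact (h k).div (continuousOn_finsetSum _ fun k _ => h k) fun X _ =>
    (Finset.sum_pos (fun k _ => Real.exp_pos _) ⟨k, Finset.mem_univ k⟩).ne'

theorem continuousOn_grad_optAux (β : ℝ) (q : Fin Q) :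
    ContinuousOn (fun X => N.grad β q X (N.optAux q X)) N.feasible := by
  have hT : ContinuousOn (fun X => (N.rxTotal q X)⁻¹) N.feasible := fun X hX =>
    ((continuousAt_inv (posDef_rxTotal hX q)).comp
      (continuous_rxTotal q).continuousAt).continuousWithinAt
  have hM : ContinuousOn (fun X => (N.rxCov q X)⁻¹) N.feasible := fun X hX =>
    ((continuousAt_inv (posDef_rxCov hX q)).comp
      (continuous_rxCov q).continuousAt).continuousWithinAt
  have hE : ∀ k, ContinuousOn (fun X => (N.eveTotal q k X)⁻¹) N.feasible := fun k X hX =>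
    ((continuousAt_inv (posDef_eveTotal hX q k)).comp
      (continuous_eveTotal q k).continuousAt).continuousWithinAt
  have hC : ∀ k, ContinuousOn (fun X => (N.eveCov q k X)⁻¹) N.feasible := fun k X hX =>
    ((continuousAt_inv (posDef_eveCov hX q k)).comp
      (continuous_eveCov q k).continuousAt).continuousWithinAt
  have hconj : ∀ {n m : ℕ} (A : Matrix (Fin m) (Fin n) ℂ),
      Continuous fun Y : CMat m => Aᴴ * Y * A := fun A => by fun_prop
  refine ((hconj (N.H q q)).comp_continuousOn hT).sub (continuousOn_finsetSum _ fun k _ =>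
      (continuousOn_softmax_optAux β q k).smul ((hconj (N.G q k)).comp_continuousOn (hE k)))
    |>.prodMk (((hconj (N.H q q)).comp_continuousOn (hT.sub hM)).sub
      (continuousOn_finsetSum _ fun k _ => (continuousOn_softmax_optAux β q k).smul
        ((hconj (N.G q k)).comp_continuousOn ((hE k).sub (hC k)))))

theorem isCompact_feasible : IsCompact N.feasible := by
  have h : N.feasible = Set.univ.pi N.strategySet := by
    ext X; simp [feasible]
  rw [h]
  exact isCompact_univ_pi fun q => isCompact_posSemidef_pairs (N.P q)

theorem convex_feasible : Convex ℝ N.feasible := by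
  have hsmul : ∀ {n : ℕ} {A : CMat n} {a : ℝ}, A.PosSemidef → 0 ≤ a → (a • A).PosSemidef :=
    fun hA ha => hA.smul ha
  intro X hX Y hY a b ha hb hab q
  obtain ⟨hX1, hX2, hX3⟩ := hX q
  obtain ⟨hY1, hY2, hY3⟩ := hY q
  refine ⟨(hsmul hX1 ha).add (hsmul hY1 hb), (hsmul hX2 ha).add (hsmul hY2 hb), ?_⟩
  have h : ((a • X + b • Y) q).1 + ((a • X + b • Y) q).2
      = a • ((X q).1 + (X q).2) + b • ((Y q).1 + (Y q).2) := by
    simp only [Pi.add_apply, Pi.smul_apply, Prod.fst_add, Prod.snd_add, Prod.smul_fst,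
      Prod.smul_snd, smul_add]
    abel
  rw [h, Matrix.trace_add, Matrix.trace_smul, Matrix.trace_smul, Complex.add_re,
    Complex.smul_re, Complex.smul_re, smul_eq_mul, smul_eq_mul]
  calc _ ≤ a * N.P q + b * N.P q :=
        add_le_add (mul_le_mul_of_nonneg_left hX3 ha) (mul_le_mul_of_nonneg_left hY3 hb)
    _ = N.P q := by rw [← add_mul, hab, one_mul]

theorem zero_mem_feasible (hP : ∀ q, 0 < N.P q) : (0 : N.Profile) ∈ N.feasible := fun q =>
  ⟨Matrix.PosSemidef.zero, Matrix.PosSemidef.zero, by simpa using (hP q).le⟩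

/-- The variational inequality with the best auxiliary matrices of each profile put into the
gradient. -/
theorem exists_solvesVI_neg_grad (hP : ∀ q, 0 < N.P q) (β : ℝ) :
    ∃ X, N.SolvesVI (fun q => -N.grad β q X (N.optAux q X)) X := by
  let F : N.Profile → N.Profile := fun X q => -N.grad β q X (N.optAux q X)
  let ℓ : N.Profile → N.Profile →ₗ[ℝ] ℝ := fun X =>
    ∑ q, (pairing (F X q)).toLinearMap ∘ₗ LinearMap.proj q
  have hℓ : ∀ X Z, ℓ X Z = ∑ q, (rinner (F X q).1 (Z q).1 + rinner (F X q).2 (Z q).2) := by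
    intro X Z
    simp only [ℓ, LinearMap.sum_apply]
    rfl
  have hF : ∀ q, ContinuousOn (fun X => F X q) N.feasible := fun q =>
    (continuousOn_grad_optAux β q).neg
  have hcont : ∀ Z ∈ N.feasible, ContinuousOn (fun X => ℓ X (Z - X)) N.feasible := by
    intro Z _
    simp only [hℓ]
    refine continuousOn_finsetSum _ fun q _ => ?_
    have h : Continuous fun p : N.Strategy q × N.Strategy q =>
        rinner p.1.1 p.2.1 + rinner p.1.2 p.2.2 := by
      unfold rinner; fun_prop
    have hZ : Continuous fun X : N.Profile => (Z - X) q := by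
      simp only [Pi.sub_apply]; fun_prop
    exact Continuous.comp_continuousOn (f := fun X => (F X q, (Z - X) q)) h
      ((hF q).prodMk hZ.continuousOn)
  obtain ⟨X, hX, hVI⟩ := exists_variationalInequality_solution isCompact_feasible convex_feasible
    ⟨0, zero_mem_feasible hP⟩ ℓ hcont
  refine ⟨X, hX, fun Z hZ => ?_⟩
  have hcomm : ∀ {n : ℕ} (A B : CMat n), rinner A B = rinner B A := by
    intro n A B
    rw [rinner, rinner, ← Matrix.conjTranspose_conjTranspose (Bᴴ * A),
      Matrix.trace_conjTranspose, Matrix.conjTranspose_mul, Matrix.conjTranspose_conjTranspose]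
    simp
  have h := hVI Z hZ
  rw [hℓ] at h
  refine h.trans_eq (Finset.sum_congr rfl fun q _ => ?_)
  rw [hcomm (F X q).1, hcomm (F X q).2]
  rfl

end Network

end SecrecyGame

theorem theorem2 {Q K : ℕ} (N : SecrecyGame.Network Q K) (hP : ∀ q, 0 < N.P q)
    (β : ℝ) (hβ : 0 < β) :
    ∃ (X : N.Profile) (S : ∀ q, N.Aux q), N.IsQNE β X S := by
  obtain ⟨X, hX⟩ := SecrecyGame.Network.exists_solvesVI_neg_grad hP β
  refine ⟨X, fun q => N.optAux q X, fun q => ⟨SecrecyGame.Network.optAux_mem hX.1 q,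
    SecrecyGame.Network.isMaxOn_optAux hX.1 hβ q⟩, _, fun q => ?_, hX⟩
  rw [neg_neg]
  exact SecrecyGame.Network.hasMatrixGradientAt_objective hβ q hX.1
    (SecrecyGame.Network.optAux_mem hX.1 q)
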